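/- Let $\mathbb H=\{z\in\mathbb C:\operatorname{Im} z>0\}$ and $\mathbb H^*=\{z\in\mathbb C:\operatorname{Im} z<0\}$. A planar domain (nonempty connected open set) $\Omega\subset\mathbb C$ is called hyperbolic if there is a holomorphic universal covering $p:\mathbb H\to\Omega$. Its hyperbolic distance is then $d_\Omega(z,w)=\inf\{d_{\mathbb H}(a,b): p(a)=z,\ p(b)=w\}$, where $d_{\mathbb H}$ is the Poincaré distance of $\mathbb H$, induced by $|dz|/\operatorname{Im} z$; it does not depend on the choice of $p$. A homeomorphism $f:\Omega\to\Omega'$ between hyperbolic planar domains is called bi-Lipschitz in the hyperbolic metrics if there is a constant $\widetilde L\ge 1$ with $$\frac1{\widetilde L}\,d_\Omega(z_1,z_2)\le d_{\Omega'}(f(z_1),f(z_2))\le \widetilde L\,d_\Omega(z_1,z_2)\qquad (z_1,z_2\in\Omega).$$ **Proposition.** Let $F:\mathbb C\to\mathbb C$ be a homeomorphism that is bi-Lipschitz in the Euclidean metric, that is, there is a constant $L\ge1$ such that $\frac1L|z-w|\le|F(z)-F(w)|\le L|z-w|$ for all $z,w\in\mathbb C$. Then $F(\mathbb H)$ and $F(\mathbb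 H^*)$ are hyperbolic planar domains, and the restrictions $F|_{\mathbb H}:\mathbb H\to F(\mathbb H)$ and $F|_{\mathbb H^*}:\mathbb H^*\to F(\mathbb H^*)$ are homeomorphisms that are bi-Lipschitz in the hyperbolic metrics. -/

import Mathlib

open scoped UpperHalfPlane Manifold

/-- `f` is bi-Lipschitz with respect to the distance functions `dX` and `dY`. -/
def IsBiLipschitzWrt {X Y : Type*} (dX : X → X → ℝ) (dY : Y → Y → ℝ) (f : X → Y) : Prop :=
  ∃ L : ℝ, 1 ≤ L ∧ ∀ x₁ x₂ : X,
    (1 / L) * dX x₁ x₂ ≤ dY (f x₁) (f x₂) ∧ dY (f x₁) (f x₂) ≤ L * dX x₁ x₂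

/-- `p` is a holomorphic universal covering of the planar set `Ω` by the upper half-plane `ℍ`
(which is simply connected). -/
structure IsHolomorphicUniversalCover (p : ℍ → ℂ) (Ω : Set ℂ) : Prop where
  holomorphic : MDifferentiable 𝓘(ℂ) 𝓘(ℂ) p
  range_eq : Set.range p = Ω
  covering : IsCoveringMapOn p Ω

/-- A hyperbolic planar domain: a (nonempty) connected open subset of `ℂ` that is
holomorphically covered by the upper half-plane. -/
structure IsHyperbolicDomain (Ω : Set ℂ) : Prop where
  isOpen : IsOpen Ω
  isConnected : IsConnected Ω
  exists_cover : ∃ p : ℍ → ℂ, IsHolomorphicUniversalCover p Ω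

/-- The hyperbolic distance of a hyperbolic planar domain: the quotient of the Poincaré distance
of `ℍ` (density `|dz| / Im z`) under the holomorphic universal covering `p : ℍ → Ω`, that is,
the smallest Poincaré distance between a lift of `z` and a lift of `w`. The covering is unique up
to precomposition with a conformal automorphism of `ℍ`, which is a Poincaré isometry, so
the infimum over the lifts is the same for every covering `p`. -/
noncomputable def hyperbolicDist (Ω : Set ℂ) (z w : ℂ) : ℝ :=
  sInf {r : ℝ | ∃ p : ℍ → ℂ, IsHolomorphicUniversalCover p Ω ∧
    ∃ a b : ℍ, p a = z ∧ p b = w ∧ r = dist a b}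

/-- A homeomorphism between planar sets is bi-Lipschitz in the hyperbolic metrics: both sets are
hyperbolic domains and the map is bi-Lipschitz for their hyperbolic distances. -/
def IsHyperbolicBiLipschitz {Ω Ω' : Set ℂ} (f : Ω ≃ₜ Ω') : Prop :=
  IsHyperbolicDomain Ω ∧ IsHyperbolicDomain Ω' ∧
    IsBiLipschitzWrt (fun z w : Ω => hyperbolicDist Ω z w)
      (fun z w : Ω' => hyperbolicDist Ω' z w) f

/-- The open lower half-plane, as a subset of `ℂ`. -/
def lowerHalfPlaneSet : Set ℂ := {z : ℂ | z.im < 0}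

open Metric Set Filter Topology ComplexConjugate

/-! Let Ω be a half-plane. Its image F(Ω) is simply connected and misses a disc, so the Riemann
mapping theorem (`exists_riemann_map`) identifies it conformally with ℍ, and
`IsConformalChart.hyperbolicDist_eq` turns its hyperbolic distance into the Poincaré distance read
in that chart.

What remains is a comparison of scales. For z in Ω the disc of radius |im z| about z lies in Ω, and
the one about conj z lies outside. Around the images of both centres F leaves such discs of radius
|im z|/L, with centres at most a bounded multiple of that radius apart. The Schwarz lemma on an
interior disc bounds hyperbolic distance above by Euclidean distance over the radius
(`tanh_half_dist_le_of_differentiableOn_ball`). An exterior disc gives the opposite bound, since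
r/(z - c) is a bounded holomorphic function on the domain
(`IsConformalChart.dist_le_of_exterior_ball`). Together they make a Euclidean Lipschitz map
hyperbolically Lipschitz at a small uniform scale, and chaining through midpoints
(`UpperHalfPlane.dist_le_mul_of_forall_dist_le`) removes the restriction on scale. This is applied
to F and to its inverse. -/

/-! ### Cayley transforms and Schwarz–Pick estimates -/

/-- The Cayley transform centred at `a`, mapping the upper half-plane to the unit disc. -/
noncomputable def cayley (a : ℍ) (z : ℂ) : ℂ := (z - a) / (z - conj (a : ℂ))

/-- The inverse Cayley transform, mapping the unit disc to the upper half-plane. -/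
noncomputable def cayleyInv (a : ℍ) (ζ : ℂ) : ℂ := (a - conj (a : ℂ) * ζ) / (1 - ζ)

theorem sub_conj_ne_zero (a : ℍ) {z : ℂ} (hz : 0 < z.im) : z - conj (a : ℂ) ≠ 0 := by
  intro h
  have h1 := congrArg Complex.im h
  simp only [Complex.sub_im, Complex.conj_im, UpperHalfPlane.coe_im, Complex.zero_im] at h1
  linarith [a.im_pos]

theorem norm_cayley_coe (a b : ℍ) : ‖cayley a b‖ = Real.tanh (dist b a / 2) := by
  rw [UpperHalfPlane.tanh_half_dist, cayley, norm_div, dist_eq_norm, dist_eq_norm]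

theorem cayley_mem_ball (a b : ℍ) : cayley a b ∈ ball (0 : ℂ) 1 := by
  rw [mem_ball_zero_iff, norm_cayley_coe]
  exact Real.tanh_lt_one _

theorem cayley_self (a : ℍ) : cayley a a = 0 := by simp [cayley]

theorem differentiableAt_cayley (a : ℍ) {z : ℂ} (hz : 0 < z.im) :
    DifferentiableAt ℂ (cayley a) z :=
  DifferentiableAt.div (by fun_prop) (by fun_prop) (sub_conj_ne_zero a hz)

theorem one_sub_ne_zero_of_mem_ball {ζ : ℂ} (hζ : ζ ∈ ball (0 : ℂ) 1) : 1 - ζ ≠ 0 := by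
  intro h
  rw [mem_ball_zero_iff, ← sub_eq_zero.1 h] at hζ
  simp at hζ

theorem differentiableOn_cayleyInv (a : ℍ) : DifferentiableOn ℂ (cayleyInv a) (ball 0 1) :=
  DifferentiableOn.div (by fun_prop) (by fun_prop) fun _ h => one_sub_ne_zero_of_mem_ball h

theorem cayleyInv_im_pos (a : ℍ) {ζ : ℂ} (hζ : ζ ∈ ball (0 : ℂ) 1) : 0 < (cayleyInv a ζ).im := by
  have h1 := one_sub_ne_zero_of_mem_ball hζ
  have h2 : 0 < Complex.normSq (1 - ζ) := Complex.normSq_pos.2 h1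
  have h3 : Complex.normSq ζ < 1 := by
    rw [mem_ball_zero_iff] at hζ
    rw [Complex.normSq_eq_norm_sq]
    nlinarith [norm_nonneg ζ]
  have h4 : (cayleyInv a ζ).im = a.im * (1 - Complex.normSq ζ) / Complex.normSq (1 - ζ) := by
    rw [cayleyInv, Complex.div_im]
    simp only [Complex.normSq_apply, Complex.sub_re, Complex.sub_im, Complex.mul_re,
      Complex.mul_im, Complex.conj_re, Complex.conj_im, Complex.one_re, Complex.one_im,
      UpperHalfPlane.coe_re, UpperHalfPlane.coe_im] at *
    field_simp
    ring
  rw [h4]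
  exact div_pos (mul_pos a.im_pos (by linarith)) h2

theorem cayley_cayleyInv (a : ℍ) {ζ : ℂ} (hζ : ζ ∈ ball (0 : ℂ) 1) :
    cayley a (cayleyInv a ζ) = ζ := by
  have h1 := one_sub_ne_zero_of_mem_ball hζ
  have h2 := sub_conj_ne_zero a (cayleyInv_im_pos a hζ)
  rw [cayley, div_eq_iff h2, cayleyInv]
  field_simp
  ring

theorem cayleyInv_cayley (a : ℍ) {z : ℂ} (hz : 0 < z.im) : cayleyInv a (cayley a z) = z := by
  have h1 := sub_conj_ne_zero a hz
  have h2 : (a : ℂ) - conj (a : ℂ) ≠ 0 := sub_conj_ne_zero a a.im_pos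
  have h3 : 1 - cayley a z = (a - conj (a : ℂ)) / (z - conj (a : ℂ)) := by
    rw [cayley]; field_simp; ring
  rw [cayleyInv, h3, cayley]
  field_simp
  ring

/-- The Schwarz lemma for holomorphic maps from a disc to the upper half-plane. -/
theorem tanh_half_dist_le_of_differentiableOn_ball {g : ℂ → ℍ} {c w : ℂ} {R : ℝ}
    (hg : DifferentiableOn ℂ (fun z => (g z : ℂ)) (ball c R)) (hw : w ∈ ball c R) :
    Real.tanh (dist (g w) (g c) / 2) ≤ dist w c / R := by
  have hd : DifferentiableOn ℂ (fun z => cayley (g c) (g z)) (ball c R) := fun z hz =>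
    DifferentiableAt.comp_differentiableWithinAt (f := fun z => (g z : ℂ)) z
      (differentiableAt_cayley (g c) (g z).im_pos) (hg z hz)
  have h := Complex.dist_le_div_mul_dist_of_mapsTo_ball (R₂ := 1) hd (fun z _ => by
    rw [cayley_self]; exact ball_subset_closedBall (cayley_mem_ball _ _)) hw
  rw [cayley_self, dist_zero_right, norm_cayley_coe] at h
  simpa [div_eq_inv_mul] using h

/-- The **Schwarz–Pick lemma**: holomorphic self-maps of the upper half-plane do not increase
Poincaré distances. -/
theorem dist_le_of_differentiableOn_upperHalfPlane {g : ℂ → ℍ}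
    (hg : DifferentiableOn ℂ (fun z => (g z : ℂ)) {z | 0 < z.im}) (a b : ℍ) :
    dist (g a) (g b) ≤ dist a b := by
  have hd : DifferentiableOn ℂ (fun ζ => (g (cayleyInv b ζ) : ℂ)) (ball 0 1) :=
    hg.comp (differentiableOn_cayleyInv b) fun ζ hζ => cayleyInv_im_pos b hζ
  have h := tanh_half_dist_le_of_differentiableOn_ball (g := fun ζ => g (cayleyInv b ζ)) hd
    (cayley_mem_ball b a)
  have hb : cayleyInv b 0 = b := by simp [cayleyInv]
  rw [cayleyInv_cayley b a.im_pos, hb, div_one, dist_zero_right, norm_cayley_coe] at h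
  have h2 := Real.artanh_le_artanh (Real.neg_one_lt_tanh _) (Real.tanh_lt_one _) h
  rw [Real.artanh_tanh, Real.artanh_tanh] at h2
  linarith

theorem Real.tanh_le_self {x : ℝ} (hx : 0 ≤ x) : Real.tanh x ≤ x := by
  rw [Real.tanh_eq_sinh_div_cosh, div_le_iff₀ (Real.cosh_pos x)]
  have hmono : MonotoneOn (fun x => x * Real.cosh x - Real.sinh x) (Ici 0) := by
    refine monotoneOn_of_deriv_nonneg (convex_Ici 0) (by fun_prop) (by fun_prop) fun y hy => ?_
    rw [interior_Ici, mem_Ioi] at hy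
    have : HasDerivAt (fun x => x * Real.cosh x - Real.sinh x)
        (1 * Real.cosh y + y * Real.sinh y - Real.cosh y) y :=
      ((hasDerivAt_id y).mul (Real.hasDerivAt_cosh y)).sub (Real.hasDerivAt_sinh y)
    rw [this.deriv]
    have := mul_nonneg hy.le (Real.sinh_nonneg_iff.2 hy.le)
    linarith
  have := hmono (mem_Ici.2 le_rfl) (mem_Ici.2 hx) hx
  simp at this
  linarith

/-- Since tanh(d/2) = (e^d - 1)/(e^d + 1), the bound gives d ≤ e^d - 1 ≤ 2t/(1 - t), and 1 - t ≥
1/2. -/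
theorem le_four_mul_of_tanh_half_le {d t : ℝ} (ht0 : 0 ≤ t) (ht : t ≤ 1 / 2) (h : Real.tanh (d / 2) ≤ t) :
    d ≤ 4 * t := by
  have he := Real.exp_pos d
  have h1 : Real.tanh (d / 2) = (Real.exp d - 1) / (Real.exp d + 1) := by
    have e1 : Real.exp d = Real.exp (d / 2) ^ 2 := by rw [sq, ← Real.exp_add]; ring_nf
    have := Real.exp_pos (d / 2)
    rw [Real.tanh_eq, Real.exp_neg, e1]
    field_simp
  rw [h1, div_le_iff₀ (by linarith)] at h
  have h2 := Real.add_one_le_exp d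
  nlinarith

/-- Bounded holomorphic functions are Lipschitz for the Poincaré distance. -/
theorem norm_sub_le_dist_of_mapsTo_unitBall {φ : ℂ → ℂ}
    (hφ : DifferentiableOn ℂ φ {z | 0 < z.im}) (hm : MapsTo φ {z | 0 < z.im} (closedBall 0 1))
    (a b : ℍ) : ‖φ a - φ b‖ ≤ dist a b := by
  have hd : DifferentiableOn ℂ (fun ζ => φ (cayleyInv b ζ)) (ball 0 1) :=
    hφ.comp (differentiableOn_cayleyInv b) fun ζ hζ => cayleyInv_im_pos b hζ
  -- Two values in the closed unit disc differ by at most 2; this factor cancels the half in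
  -- tanh(d/2) ≤ d/2.
  have h := Complex.dist_le_div_mul_dist_of_mapsTo_ball (R₂ := 2) hd (fun z hz => by
    have h1 := hm (cayleyInv_im_pos b hz)
    have h2 := hm (cayleyInv_im_pos b (mem_ball_self one_pos))
    rw [mem_closedBall, dist_zero_right] at h1 h2
    rw [mem_closedBall, dist_eq_norm]
    exact (norm_sub_le _ _).trans (by linarith)) (cayley_mem_ball b a)
  have hb : cayleyInv b 0 = b := by simp [cayleyInv]
  rw [cayleyInv_cayley b a.im_pos, hb, div_one, dist_zero_right, norm_cayley_coe,
    dist_eq_norm] at h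
  have := Real.tanh_le_self (x := dist a b / 2) (by positivity)
  linarith

/-! ### Midpoints and Lipschitz maps at a fixed scale -/

/-- Any two points of the hyperbolic plane have a midpoint. -/
theorem UpperHalfPlane.exists_dist_le_half (a b : ℍ) :
    ∃ m : ℍ, dist a m ≤ dist a b / 2 ∧ dist m b ≤ dist a b / 2 := by
  set r := dist a b / 2 with hr
  have hr0 : 0 ≤ r := by positivity
  have hs : 0 ≤ Real.sinh r := Real.sinh_nonneg_iff.2 hr0
  have hc := Real.cosh_sq r
  have hab := UpperHalfPlane.cosh_dist a b
  have hd : dist a b = 2 * r := by rw [hr]; ring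
  rw [hd, Real.cosh_two_mul] at hab
  have ha := a.im_pos
  have hb := b.im_pos
  -- Hyperbolic balls are Euclidean balls with shifted centres. Those of radius r about a and b are
  -- externally tangent, and the point of contact is the midpoint.
  have key : dist (a.center r : ℂ) (b.center r) = b.im * Real.sinh r + a.im * Real.sinh r := by
    rw [← sq_eq_sq₀ dist_nonneg (by positivity)]
    have h1 : dist (a : ℂ) b ^ 2 = 4 * a.im * b.im * Real.sinh r ^ 2 := by
      field_simp at hab
      linear_combination -hab + 2 * a.im * b.im * hc
    rw [Complex.dist_eq, Complex.sq_norm, Complex.normSq_apply] at h1 ⊢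
    simp only [Complex.sub_re, Complex.sub_im, UpperHalfPlane.coe_re, UpperHalfPlane.coe_im,
      UpperHalfPlane.center_re, UpperHalfPlane.center_im] at h1 ⊢
    linear_combination h1 + (a.im - b.im) ^ 2 * hc
  obtain ⟨y, hy1, hy2⟩ := exists_dist_le_le (mul_nonneg ha.le hs) (mul_nonneg hb.le hs) key.le
  rw [dist_comm] at hy1
  refine ⟨⟨y, UpperHalfPlane.im_pos_of_dist_center_le hy1⟩, ?_, ?_⟩
  · rw [dist_comm]
    exact UpperHalfPlane.dist_le_iff_dist_coe_center_le.2 hy1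
  · exact UpperHalfPlane.dist_le_iff_dist_coe_center_le.2 hy2

/-- A map from the hyperbolic plane that is Lipschitz at a fixed scale is Lipschitz. -/
theorem UpperHalfPlane.dist_le_mul_of_forall_dist_le {X : Type*} [PseudoMetricSpace X] {f : ℍ → X}
    {ε C : ℝ} (hε : 0 < ε) (h : ∀ a b, dist a b ≤ ε → dist (f a) (f b) ≤ C * dist a b) (a b : ℍ) :
    dist (f a) (f b) ≤ C * dist a b := by
  have key : ∀ n : ℕ, ∀ a b, dist a b ≤ 2 ^ n * ε → dist (f a) (f b) ≤ C * dist a b := by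
    intro n
    induction n with
    | zero => simpa using h
    | succ n ih =>
      intro a b hab
      by_cases h0 : dist a b ≤ 2 ^ n * ε
      · exact ih a b h0
      obtain ⟨m, h1, h2⟩ := UpperHalfPlane.exists_dist_le_half a b
      rw [pow_succ] at hab
      have h3 := ih a m (by linarith)
      have h4 := ih m b (by linarith)
      have h5 := dist_triangle a m b
      -- An equality is needed here because C has no assumed sign.
      have h6 : dist a m + dist m b = dist a b := by linarith
      calc dist (f a) (f b) ≤ dist (f a) (f m) + dist (f m) (f b) := dist_triangle _ _ _
        _ ≤ C * (dist a m + dist m b) := by linarith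
        _ = C * dist a b := by rw [h6]
  obtain ⟨n, hn⟩ := pow_unbounded_of_one_lt (dist a b / ε) one_lt_two
  exact key n a b ((div_le_iff₀ hε).1 hn.le)

/-! ### Disc automorphisms -/

/-- The automorphism of the unit disc that sends `w` to `0`. -/
noncomputable def discMoebius (w z : ℂ) : ℂ := (z - w) / (1 - conj w * z)

theorem discMoebius_self (w : ℂ) : discMoebius w w = 0 := by simp [discMoebius]

theorem one_sub_conj_mul_ne_zero {w z : ℂ} (hw : w ∈ ball (0 : ℂ) 1) (hz : z ∈ ball (0 : ℂ) 1) :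
    1 - conj w * z ≠ 0 := by
  intro h
  rw [mem_ball_zero_iff] at hw hz
  have h1 : ‖conj w * z‖ = 1 := by rw [← sub_eq_zero.1 h, norm_one]
  rw [norm_mul, Complex.norm_conj] at h1
  nlinarith [norm_nonneg w, norm_nonneg z]

/-- This is the identity |1 - conj w z|² - |z - w|² = (1 - |w|²)(1 - |z|²). -/
theorem discMoebius_mem_ball {w z : ℂ} (hw : w ∈ ball (0 : ℂ) 1) (hz : z ∈ ball (0 : ℂ) 1) :
    discMoebius w z ∈ ball (0 : ℂ) 1 := by
  have h0 := one_sub_conj_mul_ne_zero hw hz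
  rw [mem_ball_zero_iff] at hw hz ⊢
  rw [discMoebius, norm_div, div_lt_one (norm_pos_iff.2 h0), ← sq_lt_sq₀ (norm_nonneg _)
    (norm_nonneg _)]
  have h1 : 0 < (1 - ‖w‖ ^ 2) * (1 - ‖z‖ ^ 2) :=
    mul_pos (by nlinarith [norm_nonneg w]) (by nlinarith [norm_nonneg z])
  rw [Complex.sq_norm, Complex.sq_norm, Complex.normSq_apply, Complex.normSq_apply] at h1 ⊢
  simp only [Complex.sub_re, Complex.sub_im, Complex.mul_re, Complex.mul_im, Complex.conj_re,
    Complex.conj_im, Complex.one_re, Complex.one_im]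
  nlinarith

theorem injOn_discMoebius {w : ℂ} (hw : w ∈ ball (0 : ℂ) 1) :
    InjOn (discMoebius w) (ball 0 1) := by
  intro x hx y hy h
  have h1 := one_sub_conj_mul_ne_zero hw hx
  have h2 := one_sub_conj_mul_ne_zero hw hy
  have h3 := one_sub_conj_mul_ne_zero hw hw
  rw [discMoebius, discMoebius, div_eq_div_iff h1 h2] at h
  have : (x - y) * (1 - conj w * w) = 0 := by linear_combination h
  exact sub_eq_zero.1 ((mul_eq_zero.1 this).resolve_right h3)

theorem hasDerivAt_discMoebius {w z : ℂ} (hw : w ∈ ball (0 : ℂ) 1) (hz : z ∈ ball (0 : ℂ) 1) :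
    HasDerivAt (discMoebius w) ((1 - conj w * w) / (1 - conj w * z) ^ 2) z := by
  have h0 := one_sub_conj_mul_ne_zero hw hz
  have := ((hasDerivAt_id z).sub_const w).div
    (((hasDerivAt_id z).const_mul (conj w)).const_sub 1) h0
  refine this.congr_deriv ?_
  simp only [Function.id_def]
  congr 1
  ring

theorem discMoebius_eq_zero_iff {w z : ℂ} (hw : w ∈ ball (0 : ℂ) 1) (hz : z ∈ ball (0 : ℂ) 1) :
    discMoebius w z = 0 ↔ z = w := by
  rw [discMoebius, div_eq_zero_iff, or_iff_left (one_sub_conj_mul_ne_zero hw hz), sub_eq_zero]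

/-! ### Normal families and injective holomorphic functions -/

/-- **Montel's theorem** in ultrafilter form. -/
theorem exists_tendstoLocallyUniformlyOn_ultrafilter {ι : Type*} (𝒰 : Ultrafilter ι)
    {F : ι → ℂ → ℂ} {U : Set ℂ} (hU : IsOpen U) (hF : ∀ n, DifferentiableOn ℂ (F n) U)
    (hm : ∀ n, MapsTo (F n) U (closedBall 0 1)) :
    ∃ f : ℂ → ℂ, TendstoLocallyUniformlyOn F f 𝒰 U := by
  have hlim : ∀ z, ∃ y, z ∈ U → Tendsto (fun n => F n z) 𝒰 (𝓝 y) := by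
    intro z
    by_cases hz : z ∈ U
    · obtain ⟨y, -, hy⟩ := (isCompact_closedBall (0 : ℂ) 1).ultrafilter_le_nhds
        (𝒰.map fun n => F n z) (le_principal_iff.2 (mem_map.2 (univ_mem' fun n => hm n hz)))
      exact ⟨y, fun _ => hy⟩
    · exact ⟨0, fun h => absurd h hz⟩
  choose f hf using hlim
  refine ⟨f, Metric.tendstoLocallyUniformlyOn_iff.2 fun ε hε z hz => ?_⟩
  obtain ⟨R, hR, hRU⟩ := Metric.isOpen_iff.1 hU z hz
  -- The Schwarz lemma makes the family equi-Lipschitz near z, which upgrades the pointwise limit to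
  -- a locally uniform one.
  have hlip : ∀ n, ∀ w ∈ ball z R, dist (F n w) (F n z) ≤ 2 / R * dist w z := fun n w hw =>
    Complex.dist_le_div_mul_dist_of_mapsTo_ball ((hF n).mono hRU) (fun x hx => by
      have h1 := hm n (hRU hx)
      have h2 := hm n hz
      rw [mem_closedBall, dist_zero_right] at h1 h2
      rw [mem_closedBall, dist_eq_norm]
      exact (norm_sub_le _ _).trans (by linarith)) hw
  have hlip' : ∀ w ∈ ball z R, dist (f w) (f z) ≤ 2 / R * dist w z := fun w hw =>
    le_of_tendsto' ((hf w (hRU hw)).dist (hf z hz)) fun n => hlip n w hw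
  set δ := min R (ε * R / 8) with hδ
  have hδ0 : 0 < δ := lt_min hR (by positivity)
  refine ⟨ball z δ, mem_nhdsWithin_of_mem_nhds (ball_mem_nhds z hδ0), ?_⟩
  filter_upwards [Metric.tendsto_nhds.1 (hf z hz) (ε / 4) (by positivity)] with n hn w hw
  have hwR : w ∈ ball z R := ball_subset_ball (min_le_left _ _) hw
  have hw' : 2 / R * dist w z ≤ ε / 4 := by
    have : dist w z ≤ ε * R / 8 := (mem_ball.1 hw).le.trans (min_le_right _ _)
    calc 2 / R * dist w z ≤ 2 / R * (ε * R / 8) := by gcongr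
      _ = ε / 4 := by field_simp; norm_num
  have h1 := hlip n w hwR
  have h2 := hlip' w hwR
  have h3 := dist_triangle4 (f w) (f z) (F n z) (F n w)
  rw [dist_comm (f z), dist_comm (F n z) (F n w)] at h3
  linarith

/-- **Hurwitz's theorem**: a nonconstant locally uniform limit of injective holomorphic functions
is injective. -/
theorem injOn_of_tendstoLocallyUniformlyOn {ι : Type*} {φ : Filter ι} [φ.NeBot] {F : ι → ℂ → ℂ}
    {f : ℂ → ℂ} {U : Set ℂ} (hU : IsOpen U) (hUc : IsPreconnected U)
    (hF : ∀ n, DifferentiableOn ℂ (F n) U) (hinj : ∀ n, InjOn (F n) U)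
    (hlim : TendstoLocallyUniformlyOn F f φ U) {z₀ : ℂ} (hz₀ : z₀ ∈ U) (hd : deriv f z₀ ≠ 0) :
    InjOn f U := by
  have hfd : DifferentiableOn ℂ f U := hlim.differentiableOn (Eventually.of_forall hF) hU
  have hfa := hfd.analyticOnNhd hU
  intro a ha b hb hab
  by_contra hne
  rcases (hfa b hb).eventually_eq_or_eventually_ne (analyticAt_const (v := f b)) with h | h
  · refine hd ?_
    have h1 := hfa.eqOn_of_preconnected_of_eventuallyEq analyticOnNhd_const hUc hb h
    have h2 : f =ᶠ[𝓝 z₀] fun _ => f b := by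
      filter_upwards [hU.mem_nhds hz₀] with z hz using h1 hz
    rw [h2.deriv_eq, deriv_const]
  obtain ⟨r, hr, hrs⟩ := (nhdsWithin_hasBasis nhds_basis_closedBall _).mem_iff.1
    (inter_mem h (nhdsWithin_le_nhds (inter_mem (hU.mem_nhds hb)
      (isOpen_ne.mem_nhds (Ne.symm hne) : {z | z ≠ a} ∈ 𝓝 b))))
  have hrU : closedBall b r ⊆ U := fun z hz => by
    by_cases hzb : z = b
    · exact hzb ▸ hb
    · exact (hrs ⟨hz, hzb⟩).2.1
  have har : a ∉ closedBall b r := fun h => (hrs ⟨h, hne⟩).2.2 rfl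
  obtain ⟨x, hx, hxm⟩ := (isCompact_sphere b r).exists_isMinOn (NormedSpace.sphere_nonempty.2 hr.le)
    ((hfd.continuousOn.mono (sphere_subset_closedBall.trans hrU)).sub
      (continuousOn_const (c := f b))).norm
  set m := ‖f x - f b‖ with hm
  have hm0 : 0 < m := norm_pos_iff.2 (sub_ne_zero.2
    (hrs ⟨sphere_subset_closedBall hx, ne_of_mem_sphere hx hr.ne'⟩).1)
  -- With error m/8, F n stays at least m/2 away from F n b on the circle, so it covers the disc of
  -- radius m/4 about F n b. That disc contains F n a, because f a = f b, and injectivity fails.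
  have hunif := Metric.tendstoUniformlyOn_iff.1
    ((tendstoLocallyUniformlyOn_iff_forall_isCompact hU).1 hlim _ hrU (isCompact_closedBall b r))
    (m / 8) (by positivity)
  obtain ⟨n, hn, hna⟩ := (hunif.and (Metric.tendsto_nhds.1 (hlim.tendsto_at ha) (m / 8)
    (by positivity))).exists
  have hbb := hn b (mem_closedBall_self hr.le)
  have himg : ball (F n b) (m / 2 / 2) ⊆ F n '' closedBall b r := by
    refine DiffContOnCl.ball_subset_image_closedBall
      (((hF n).mono (closure_ball_subset_closedBall.trans hrU)).diffContOnCl) hr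
      (fun z hz => ?_) ?_
    · have h1 := hn z (sphere_subset_closedBall hz)
      have h2 : m ≤ dist (f z) (f b) := by rw [dist_eq_norm]; exact hxm hz
      have h3 := dist_triangle4 (f z) (F n z) (F n b) (f b)
      rw [dist_comm (F n b)] at h3
      rw [← dist_eq_norm]
      linarith
    · have : ∀ᶠ z in 𝓝[≠] b, F n z ≠ F n b := by
        filter_upwards [nhdsWithin_le_nhds (hU.mem_nhds hb), self_mem_nhdsWithin] with z hz hzb
        exact fun h => hzb (hinj n hz hb h)
      exact this.frequently.filter_mono nhdsWithin_le_nhds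
  obtain ⟨y, hy, hya⟩ := himg (show F n a ∈ ball (F n b) (m / 2 / 2) by
    have h3 := dist_triangle (F n a) (f a) (F n b)
    rw [hab] at h3 hna
    rw [mem_ball]
    linarith)
  exact har (hinj n (hrU hy) ha hya ▸ hy)

/-- An injective holomorphic function is an open map with holomorphic inverse. -/
theorem exists_differentiableOn_leftInvOn {f : ℂ → ℂ} {U : Set ℂ} (hU : IsOpen U)
    (hf : DifferentiableOn ℂ f U) (hinj : InjOn f U) :
    IsOpen (f '' U) ∧ ∃ g : ℂ → ℂ, DifferentiableOn ℂ g (f '' U) ∧ LeftInvOn g f U := by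
  have hfa := hf.analyticOnNhd hU
  have hnc : ∀ z ∈ U, ¬ ∀ᶠ y in 𝓝 z, f y = f z := fun z hz h => by
    have h1 : ∀ᶠ y in 𝓝[≠] z, False := by
      filter_upwards [nhdsWithin_le_nhds h, nhdsWithin_le_nhds (hU.mem_nhds hz),
        self_mem_nhdsWithin] with y hy hyU hne using hne (hinj hyU hz hy)
    exact (h1.exists).choose_spec
  have hmap : ∀ z ∈ U, 𝓝 (f z) ≤ map f (𝓝 z) := fun z hz =>
    (hfa z hz).eventually_constant_or_nhds_le_map_nhds.resolve_left (hnc z hz)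
  have hopen : IsOpen (f '' U) := isOpen_iff_mem_nhds.2 (by
    rintro _ ⟨z, hz, rfl⟩
    exact hmap z hz (image_mem_map (hU.mem_nhds hz)))
  set g := Function.invFunOn f U with hg
  have hgl : LeftInvOn g f U := hinj.leftInvOn_invFunOn
  have hgr : ∀ y ∈ f '' U, f (g y) = y := by
    rintro _ ⟨z, hz, rfl⟩
    rw [hgl hz]
  have hgc : ∀ z ∈ U, ContinuousAt g (f z) := by
    intro z hz
    have h1 : Tendsto g (map f (𝓝 z)) (𝓝 z) := by
      rw [tendsto_map'_iff]
      refine tendsto_id.congr' ?_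
      filter_upwards [hU.mem_nhds hz] with y hy using (hgl hy).symm
    rw [ContinuousAt, hgl hz]
    exact h1.mono_left (hmap z hz)
  have hreg : ∀ z ∈ U, deriv f z ≠ 0 → DifferentiableAt ℂ g (f z) := by
    intro z hz hd
    refine (HasDerivAt.of_local_left_inverse (f := f) (f' := deriv f z) (hgc z hz) ?_ hd
      ?_).differentiableAt
    · rw [hgl hz]
      exact (hfa z hz).differentiableAt.hasDerivAt
    · filter_upwards [hopen.mem_nhds (mem_image_of_mem f hz)] with y hy using hgr y hy
  refine ⟨hopen, g, ?_, hgl⟩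
  rintro _ ⟨z, hz, rfl⟩
  -- Critical points of f are isolated, so g is holomorphic on a punctured neighbourhood and
  -- continuous at the centre: the singularity is removable.
  refine (Complex.analyticAt_of_differentiable_on_punctured_nhds_of_continuousAt ?_
    (hgc z hz)).differentiableAt.differentiableWithinAt
  have hd : ∀ᶠ y in 𝓝[≠] z, deriv f y ≠ 0 := by
    rcases (hfa z hz).deriv.eventually_eq_zero_or_eventually_ne_zero with h | h
    · exfalso
      obtain ⟨r, hr, hrs⟩ := Metric.mem_nhds_iff.1 (inter_mem h (hU.mem_nhds hz))
      refine hnc z hz ?_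
      filter_upwards [ball_mem_nhds z hr] with y hy
      refine (convex_ball z r).is_const_of_fderivWithin_eq_zero (𝕜 := ℂ)
        (hf.mono fun x hx => (hrs hx).2) (fun x hx => ?_) hy (mem_ball_self hr)
      rw [fderivWithin_of_isOpen isOpen_ball hx]
      ext
      simpa using (hrs hx).1
    · exact h
  have ht : Tendsto g (𝓝[≠] (f z)) (𝓝[≠] z) := by
    refine tendsto_nhdsWithin_iff.2 ⟨?_, ?_⟩
    · have := hgc z hz
      rw [ContinuousAt, hgl hz] at this
      exact this.mono_left nhdsWithin_le_nhds
    · filter_upwards [self_mem_nhdsWithin,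
        nhdsWithin_le_nhds (hopen.mem_nhds (mem_image_of_mem f hz))] with y hy hyU h
      exact hy (by rw [mem_singleton_iff, ← hgr y hyU, mem_singleton_iff.1 h])
  filter_upwards [ht.eventually hd,
    nhdsWithin_le_nhds (hopen.mem_nhds (mem_image_of_mem f hz))] with y hy hyU
  obtain ⟨x, hx, rfl⟩ := hyU
  rw [hgl hx] at hy
  exact hreg x hx hy

theorem deriv_ne_zero_of_injOn {f : ℂ → ℂ} {U : Set ℂ} (hU : IsOpen U)
    (hf : DifferentiableOn ℂ f U) (hinj : InjOn f U) {z : ℂ} (hz : z ∈ U) : deriv f z ≠ 0 := by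
  obtain ⟨ho, g, hg, hgf⟩ := exists_differentiableOn_leftInvOn hU hf hinj
  have h1 := ((hg.differentiableAt (ho.mem_nhds (mem_image_of_mem f hz))).hasDerivAt).comp z
    (hf.differentiableAt (hU.mem_nhds hz)).hasDerivAt
  have h2 : g ∘ f =ᶠ[𝓝 z] id := by
    filter_upwards [hU.mem_nhds hz] with y hy using hgf hy
  have h3 := (h1.congr_of_eventuallyEq h2.symm).unique (hasDerivAt_id z)
  intro h
  rw [h, mul_zero] at h3
  exact zero_ne_one h3

/-! ### The Riemann mapping theorem by Koebe's extremal argument -/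

/-- Injective holomorphic maps from `U` to the unit disc sending `z₀` to the centre. -/
structure IsDiscEmbedding (U : Set ℂ) (z₀ : ℂ) (f : ℂ → ℂ) : Prop where
  differentiableOn : DifferentiableOn ℂ f U
  injOn : InjOn f U
  mapsTo : MapsTo f U (ball 0 1)
  map_base : f z₀ = 0

theorem isDiscEmbedding_discMoebius_comp {U : Set ℂ} {z₀ : ℂ} (hz₀ : z₀ ∈ U) {f : ℂ → ℂ}
    (hf : DifferentiableOn ℂ f U) (hinj : InjOn f U) (hm : MapsTo f U (ball 0 1)) :
    IsDiscEmbedding U z₀ (fun z => discMoebius (f z₀) (f z)) where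
  differentiableOn := fun z hz => DifferentiableAt.comp_differentiableWithinAt (f := f) z
    (hasDerivAt_discMoebius (hm hz₀) (hm hz)).differentiableAt (hf z hz)
  injOn := (injOn_discMoebius (hm hz₀)).comp hinj hm
  mapsTo := fun _ hz => discMoebius_mem_ball (hm hz₀) (hm hz)
  map_base := discMoebius_self _

/-- The Koebe square root trick: a disc embedding of a simply connected domain that is not onto
can be improved to have a larger derivative at the base point. -/
theorem IsDiscEmbedding.exists_norm_deriv_lt {U : Set ℂ} (hU : IsOpen U) (hUc : IsSimplyConnected U)
    {z₀ : ℂ} (hz₀ : z₀ ∈ U) {f : ℂ → ℂ} (hf : IsDiscEmbedding U z₀ f) {w : ℂ}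
    (hw : w ∈ ball (0 : ℂ) 1) (hwf : w ∉ f '' U) :
    ∃ h, IsDiscEmbedding U z₀ h ∧ ‖deriv f z₀‖ < ‖deriv h z₀‖ := by
  have hw0 : w ≠ 0 := fun h => hwf ⟨z₀, hz₀, by rw [hf.map_base, h]⟩
  set k : ℂ → ℂ := fun z => discMoebius w (f z) with hk
  have hkd : ∀ z ∈ U, HasDerivAt k
      ((1 - conj w * w) / (1 - conj w * f z) ^ 2 * deriv f z) z := fun z hz =>
    (hasDerivAt_discMoebius hw (hf.mapsTo hz)).comp z
      (hf.differentiableOn.differentiableAt (hU.mem_nhds hz)).hasDerivAt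
  have hkm : ∀ z ∈ U, k z ∈ ball (0 : ℂ) 1 := fun z hz => discMoebius_mem_ball hw (hf.mapsTo hz)
  have hk0 : ∀ z ∈ U, k z ≠ 0 := fun z hz h =>
    hwf ⟨z, hz, (discMoebius_eq_zero_iff hw (hf.mapsTo hz)).1 h⟩
  -- The one use of simple connectedness: the zero-free function k has a continuous square root.
  obtain ⟨s, hsc, hs⟩ := Complex.exists_continuousOn_pow_eq hUc hU (g := k)
    (fun z hz => (hkd z hz).continuousAt.continuousWithinAt)
    (by rintro ⟨z, hz, h⟩; exact hk0 z hz h) two_ne_zero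
  have hs0 : ∀ z ∈ U, s z ≠ 0 := fun z hz h => hk0 z hz (by rw [← hs z, h]; norm_num)
  have hsd : ∀ z ∈ U, HasDerivAt s
      ((1 - conj w * w) / (1 - conj w * f z) ^ 2 * deriv f z * (s z + s z)⁻¹) z := by
    intro z hz
    have hsz := hsc.continuousAt (hU.mem_nhds hz)
    have hsum : s z + s z ≠ 0 := by rw [← two_mul]; exact mul_ne_zero two_ne_zero (hs0 z hz)
    have hc : ContinuousAt (fun y => s y + s z) z := hsz.add continuousAt_const
    rw [hasDerivAt_iff_tendsto_slope]
    refine ((hasDerivAt_iff_tendsto_slope.1 (hkd z hz)).mul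
      ((hc.mono_left nhdsWithin_le_nhds).inv₀ hsum)).congr' ?_
    filter_upwards [nhdsWithin_le_nhds (hc.eventually_ne hsum)] with y hy
    rw [slope_def_field, slope_def_field, ← hs y, ← hs z]
    field_simp
    ring
  have hsi : InjOn s U := fun x hx y hy h => hf.injOn hx hy
    (injOn_discMoebius hw (hf.mapsTo hx) (hf.mapsTo hy)
      (show k x = k y by rw [← hs x, ← hs y, h]))
  have hsm : MapsTo s U (ball 0 1) := fun z hz => by
    have := hkm z hz
    rw [mem_ball_zero_iff, ← hs z, norm_pow] at this
    rw [mem_ball_zero_iff]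
    nlinarith [norm_nonneg (s z)]
  refine ⟨_, isDiscEmbedding_discMoebius_comp hz₀
    (fun z hz => (hsd z hz).differentiableAt.differentiableWithinAt) hsi hsm, ?_⟩
  have hder := ((hasDerivAt_discMoebius (hsm hz₀) (hsm hz₀)).comp z₀ (hsd z₀ hz₀)).deriv
  rw [show (fun z => discMoebius (s z₀) (s z)) = discMoebius (s z₀) ∘ s from rfl, hder]
  set t := ‖s z₀‖ with ht
  have ht0 : 0 < t := norm_pos_iff.2 (hs0 z₀ hz₀)
  have ht1 : t < 1 := mem_ball_zero_iff.1 (hsm hz₀)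
  have htw : ‖w‖ = t ^ 2 := by
    rw [ht, ← norm_pow, hs z₀, hk]
    simp [discMoebius, hf.map_base]
  have hnorm : ∀ v : ℂ, ‖v‖ < 1 → ‖1 - conj v * v‖ = 1 - ‖v‖ ^ 2 := fun v hv => by
    rw [Complex.conj_mul', ← Complex.ofReal_pow, ← Complex.ofReal_one, ← Complex.ofReal_sub,
      Complex.norm_real, Real.norm_of_nonneg (by nlinarith [norm_nonneg v])]
  have hfd := norm_pos_iff.2 (deriv_ne_zero_of_injOn hU hf.differentiableOn hf.injOn hz₀)
  have hsq : 0 < 1 - t ^ 2 := by nlinarith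
  rw [hf.map_base, mul_zero, sub_zero, one_pow, div_one, norm_mul, norm_mul, norm_mul, norm_div,
    norm_pow, hnorm w (mem_ball_zero_iff.1 hw), hnorm (s z₀) ht1, norm_inv, ← two_mul, norm_mul,
    Complex.norm_two, htw, ← ht]
  -- As |w| = t², the derivative grows by the factor (1 + t²)/(2t), which exceeds 1 for 0 < t < 1.
  have : (1 - t ^ 2) / (1 - t ^ 2) ^ 2 * ((1 - (t ^ 2) ^ 2) * ‖deriv f z₀‖ * (2 * t)⁻¹) =
      ‖deriv f z₀‖ * ((1 + t ^ 2) / (2 * t)) := by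
    field_simp
    ring
  rw [this]
  refine lt_mul_of_one_lt_right hfd ?_
  rw [one_lt_div (by positivity)]
  nlinarith [sq_nonneg (1 - t), mul_pos (sub_pos.2 ht1) (sub_pos.2 ht1)]

/-- There is a disc embedding with the largest possible derivative at the base point. -/
theorem IsDiscEmbedding.exists_isMaxOn {U : Set ℂ} (hU : IsOpen U) (hUc : IsPreconnected U)
    {z₀ : ℂ} (hz₀ : z₀ ∈ U) {f₀ : ℂ → ℂ} (hf₀ : IsDiscEmbedding U z₀ f₀) :
    ∃ f, IsDiscEmbedding U z₀ f ∧ ∀ h, IsDiscEmbedding U z₀ h → ‖deriv h z₀‖ ≤ ‖deriv f z₀‖ := by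
  obtain ⟨R, hR, hRU⟩ := Metric.isOpen_iff.1 hU z₀ hz₀
  set S : Set ℝ := (fun h : ℂ → ℂ => ‖deriv h z₀‖) '' {h | IsDiscEmbedding U z₀ h} with hS
  have hbdd : BddAbove S := by
    refine ⟨1 / R, ?_⟩
    rintro _ ⟨h, hh, rfl⟩
    refine Complex.norm_deriv_le_div_of_mapsTo_ball (hh.differentiableOn.mono hRU)
      (fun x hx => ?_) hR
    rw [hh.map_base]
    exact ball_subset_closedBall (hh.mapsTo (hRU hx))
  obtain ⟨u, -, hu, huS⟩ := exists_seq_tendsto_sSup (S := S) ⟨_, f₀, hf₀, rfl⟩ hbdd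
  choose F hF hFu using huS
  obtain ⟨f, hlim⟩ := exists_tendstoLocallyUniformlyOn_ultrafilter (hyperfilter ℕ) hU
    (fun n => (hF n).differentiableOn) (fun n z hz => ball_subset_closedBall ((hF n).mapsTo hz))
  have hev := Eventually.of_forall (f := (hyperfilter ℕ : Filter ℕ))
    fun n => (hF n).differentiableOn
  have hfd : DifferentiableOn ℂ f U := hlim.differentiableOn hev hU
  have hderiv : ‖deriv f z₀‖ = sSup S := by
    refine tendsto_nhds_unique ((hlim.deriv hev hU).tendsto_at hz₀).norm
      ((hu.mono_left Nat.hyperfilter_le_atTop).congr fun n => ?_)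
    exact (hFu n).symm
  have hmax : ∀ h, IsDiscEmbedding U z₀ h → ‖deriv h z₀‖ ≤ ‖deriv f z₀‖ := fun h hh =>
    hderiv ▸ le_csSup hbdd ⟨h, hh, rfl⟩
  -- The limit is at least as good as f₀, hence nonconstant, as Hurwitz's theorem requires.
  have hd0 : deriv f z₀ ≠ 0 := norm_pos_iff.1 ((norm_pos_iff.2
    (deriv_ne_zero_of_injOn hU hf₀.differentiableOn hf₀.injOn hz₀)).trans_le (hmax f₀ hf₀))
  have hbase : f z₀ = 0 := tendsto_nhds_unique (hlim.tendsto_at hz₀)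
    (tendsto_const_nhds.congr fun n => (hF n).map_base.symm)
  have hle : ∀ z ∈ U, ‖f z‖ ≤ 1 := fun z hz => le_of_tendsto' (hlim.tendsto_at hz).norm
    fun n => (mem_ball_zero_iff.1 ((hF n).mapsTo hz)).le
  refine ⟨f, ⟨hfd, injOn_of_tendstoLocallyUniformlyOn hU hUc (fun n => (hF n).differentiableOn)
    (fun n => (hF n).injOn) hlim hz₀ hd0, fun z hz => ?_, hbase⟩, hmax⟩
  rw [mem_ball_zero_iff]
  refine (hle z hz).lt_of_ne fun h => ?_
  have := Complex.norm_eqOn_of_isPreconnected_of_isMaxOn hUc hU hfd hz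
    (fun y hy => by simpa [h] using hle y hy) hz₀
  simp [hbase, h] at this

/-- The **Riemann mapping theorem** for simply connected domains whose complement contains a
disc. -/
theorem exists_riemann_map {U : Set ℂ} (hU : IsOpen U) (hUc : IsSimplyConnected U)
    {c : ℂ} {r : ℝ} (hr : 0 < r) (hc : Disjoint (ball c r) U) :
    ∃ f : ℂ → ℂ, DifferentiableOn ℂ f U ∧ InjOn f U ∧ f '' U = ball 0 1 := by
  obtain ⟨z₀, hz₀⟩ := hUc.nonempty
  have hdist : ∀ z ∈ U, r ≤ ‖z - c‖ := fun z hz => by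
    by_contra h
    exact Set.disjoint_right.1 hc hz (by rw [mem_ball_iff_norm]; exact not_le.1 h)
  have hne : ∀ z ∈ U, z - c ≠ 0 := fun z hz => norm_pos_iff.1 (hr.trans_le (hdist z hz))
  -- Inversion in the omitted disc embeds U in the disc of radius 1/2, so the extremal problem has a
  -- competitor.
  have hemb := isDiscEmbedding_discMoebius_comp (f := fun z => (r / 2 : ℂ) / (z - c)) hz₀
    (DifferentiableOn.div (by fun_prop) (by fun_prop) hne)
    (fun x hx y hy h => by
      have h1 : (r / 2 : ℂ) ≠ 0 := by
        simpa using hr.ne'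
      have h2 := hne x hx
      have h3 := hne y hy
      simp only at h
      rw [div_eq_div_iff h2 h3] at h
      linear_combination -(mul_left_cancel₀ h1 h))
    (fun z hz => by
      have h1 := hdist z hz
      rw [mem_ball_zero_iff, norm_div, div_lt_one (hr.trans_le h1), norm_div, Complex.norm_real,
        Real.norm_of_nonneg hr.le, Complex.norm_two]
      linarith)
  obtain ⟨f, hf, hmax⟩ := hemb.exists_isMaxOn hU hUc.isPathConnected.isConnected.isPreconnected hz₀
  refine ⟨f, hf.differentiableOn, hf.injOn, (image_subset_iff.2 hf.mapsTo).antisymm fun w hw => ?_⟩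
  by_contra hwf
  obtain ⟨h, hh, hlt⟩ := hf.exists_norm_deriv_lt hU hUc hz₀ hw hwf
  exact absurd (hmax h hh) (not_le.2 hlt)

/-! ### Conformal charts and hyperbolic distance -/

/-- `p` is a conformal equivalence from the upper half-plane onto `Ω`, with inverse `q`. -/
structure IsConformalChart (p : ℍ → ℂ) (q : ℂ → ℍ) (Ω : Set ℂ) : Prop where
  mdifferentiable : MDifferentiable 𝓘(ℂ) 𝓘(ℂ) p
  differentiableOn : DifferentiableOn ℂ (fun z => (q z : ℂ)) Ω
  mem : ∀ a, p a ∈ Ω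
  left_inv : ∀ a, q (p a) = a
  right_inv : ∀ z ∈ Ω, p (q z) = z

namespace IsConformalChart

variable {p p' : ℍ → ℂ} {q q' : ℂ → ℍ} {Ω Ω' : Set ℂ}

theorem range_eq (h : IsConformalChart p q Ω) : range p = Ω :=
  (range_subset_iff.2 h.mem).antisymm fun z hz => ⟨q z, h.right_inv z hz⟩

theorem isHolomorphicUniversalCover (h : IsConformalChart p q Ω) (hΩ : IsOpen Ω) :
    IsHolomorphicUniversalCover p Ω where
  holomorphic := h.mdifferentiable
  range_eq := h.range_eq
  covering := by
    have hq : ContinuousOn q Ω := by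
      rw [UpperHalfPlane.isOpenEmbedding_coe.isEmbedding.continuousOn_iff]
      exact h.differentiableOn.continuousOn
    let e : ℍ ≃ₜ Ω :=
      { toFun := fun a => ⟨p a, h.mem a⟩
        invFun := fun z => q z
        left_inv := h.left_inv
        right_inv := fun z => Subtype.ext (h.right_inv z z.2)
        continuous_toFun := h.mdifferentiable.continuous.subtype_mk _
        continuous_invFun := continuousOn_iff_continuous_domRestrict.1 hq }
    have hpre : p ⁻¹' Ω = univ := eq_univ_of_forall h.mem
    exact fun z hz => IsEvenlyCovered.to_isEvenlyCovered_preimage (I := PUnit.{1})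
      ⟨inferInstance, Ω, hz, hΩ, hpre ▸ isOpen_univ, (Homeomorph.setCongr hpre).trans
        ((Homeomorph.Set.univ ℍ).trans (e.trans (Homeomorph.prodPUnit _).symm)), fun _ => rfl⟩

theorem isHyperbolicDomain (h : IsConformalChart p q Ω) (hΩ : IsOpen Ω) :
    IsHyperbolicDomain Ω where
  isOpen := hΩ
  isConnected := h.range_eq ▸ isConnected_range h.mdifferentiable.continuous
  exists_cover := ⟨p, h.isHolomorphicUniversalCover hΩ⟩

/-- The chart attains the value. For any other covering p', q ∘ p' is a holomorphic self-map of ℍ,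
so Schwarz–Pick shows that no pair of lifts is closer; uniqueness of coverings is not needed. -/
theorem hyperbolicDist_eq (h : IsConformalChart p q Ω) (hΩ : IsOpen Ω) {z w : ℂ} (hz : z ∈ Ω)
    (hw : w ∈ Ω) : hyperbolicDist Ω z w = dist (q z) (q w) := by
  refine IsLeast.csInf_eq ⟨⟨p, h.isHolomorphicUniversalCover hΩ, q z, q w, h.right_inv z hz,
    h.right_inv w hw, rfl⟩, ?_⟩
  rintro _ ⟨p', hp', a, b, rfl, rfl, rfl⟩
  have hd : DifferentiableOn ℂ (fun ζ => (q (p' (UpperHalfPlane.ofComplex ζ)) : ℂ))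
      {ζ | 0 < ζ.im} :=
    h.differentiableOn.comp (UpperHalfPlane.mdifferentiable_iff.1 hp'.holomorphic)
      fun ζ _ => hp'.range_eq ▸ mem_range_self _
  have := dist_le_of_differentiableOn_upperHalfPlane
    (g := fun ζ => q (p' (UpperHalfPlane.ofComplex ζ))) hd a b
  simpa only [UpperHalfPlane.ofComplex_apply] using this

/-- If the complement of `Ω` contains a disc of radius `r` at distance at most `K * r` from `p a`,
then `p` is Lipschitz at `a`, at scale `r`. -/
theorem dist_le_of_exterior_ball (h : IsConformalChart p q Ω) {a b : ℍ} {c : ℂ} {r K : ℝ}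
    (hr : 0 < r) (hc : Disjoint (ball c r) Ω) (hK : dist (p a) c ≤ K * r)
    (hab : K * dist a b ≤ 1 / 2) : dist (p a) (p b) ≤ 2 * K ^ 2 * r * dist a b := by
  have hdist : ∀ z ∈ Ω, r ≤ ‖z - c‖ := fun z hz => by
    by_contra h
    exact Set.disjoint_right.1 hc hz (by rw [mem_ball_iff_norm]; exact not_le.1 h)
  have hne : ∀ z ∈ Ω, z - c ≠ 0 := fun z hz => norm_pos_iff.1 (hr.trans_le (hdist z hz))
  have hφ : DifferentiableOn ℂ (fun ζ => (r : ℂ) / (p (UpperHalfPlane.ofComplex ζ) - c))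
      {ζ | 0 < ζ.im} :=
    DifferentiableOn.div (differentiableOn_const _)
      ((UpperHalfPlane.mdifferentiable_iff.1 h.mdifferentiable).sub_const c)
      fun ζ _ => hne _ (h.mem _)
  have hmaps : MapsTo (fun ζ => (r : ℂ) / (p (UpperHalfPlane.ofComplex ζ) - c))
      {ζ | 0 < ζ.im} (closedBall 0 1) := fun ζ _ => by
    have h1 := hdist _ (h.mem (UpperHalfPlane.ofComplex ζ))
    rw [mem_closedBall, dist_zero_right, norm_div, div_le_one (hr.trans_le h1),
      Complex.norm_real, Real.norm_of_nonneg hr.le]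
    exact h1
  have key := norm_sub_le_dist_of_mapsTo_unitBall hφ hmaps a b
  simp only [UpperHalfPlane.ofComplex_apply] at key
  have ha := hne _ (h.mem a)
  have hb := hne _ (h.mem b)
  rw [div_sub_div _ _ ha hb, norm_div, norm_mul (p a - c),
    div_le_iff₀ (mul_pos (norm_pos_iff.2 ha) (norm_pos_iff.2 hb)),
    show (r : ℂ) * (p b - c) - (p a - c) * r = r * (p b - p a) by ring, norm_mul,
    Complex.norm_real, Real.norm_of_nonneg hr.le, ← dist_eq_norm, ← dist_eq_norm,
    ← dist_eq_norm, dist_comm (p b) (p a)] at key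
  set D := dist (p a) (p b)
  set d := dist a b
  have hd : 0 ≤ d := dist_nonneg
  have hD : 0 ≤ D := dist_nonneg
  have hK0 : 0 ≤ K * r := dist_nonneg.trans hK
  have hbc : dist (p b) c ≤ D + K * r := by
    have := dist_triangle (p b) (p a) c
    rw [dist_comm (p b) (p a)] at this
    linarith
  have h1 : r * D ≤ d * (K * r * (D + K * r)) := key.trans (by gcongr)
  have h2 : D ≤ d * K * (D + K * r) := by
    refine le_of_mul_le_mul_left (h1.trans_eq ?_) hr
    ring
  -- Since d * K ≤ 1/2, the term d * K * D is absorbed into the left side.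
  nlinarith

/-- A Euclidean Lipschitz map between conformally charted domains is Lipschitz for the Poincaré
distances, provided that at each point it respects a common scale of interior and exterior
discs. -/
theorem exists_dist_le_mul_dist (h : IsConformalChart p q Ω) (h' : IsConformalChart p' q' Ω')
    {f : ℂ → ℂ} {r : ℂ → ℝ} {L K : ℝ} (hL : 0 < L) (hK : 0 < K)
    (hr : ∀ z ∈ Ω, 0 < r z)
    (hf : ∀ z ∈ Ω, ∀ w ∈ Ω, dist (f z) (f w) ≤ L * dist z w)
    (hint : ∀ z ∈ Ω, ball (f z) (r z) ⊆ Ω')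
    (hext : ∀ z ∈ Ω, ∃ c, Disjoint (ball c (r z)) Ω ∧ dist z c ≤ K * r z) :
    ∃ C : ℝ, ∀ z ∈ Ω, ∀ w ∈ Ω, dist (q' (f z)) (q' (f w)) ≤ C * dist (q z) (q w) := by
  -- The factor 2K² comes from the exterior disc, L from f, and 4 from inverting tanh. The two terms
  -- of the scale below keep K * dist and 2LK² * dist at most 1/2.
  refine ⟨8 * L * K ^ 2, fun z hz w hw => ?_⟩
  have hε : 0 < min (1 / (2 * K)) (1 / (4 * L * K ^ 2)) := by positivity
  have key := UpperHalfPlane.dist_le_mul_of_forall_dist_le (f := fun a => q' (f (p a)))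
    (C := 8 * L * K ^ 2) hε (fun a b hab => ?_) (q z) (q w)
  · simpa only [h.right_inv z hz, h.right_inv w hw] using key
  have hra := hr _ (h.mem a)
  obtain ⟨c, hc, hcK⟩ := hext _ (h.mem a)
  have h1 : K * dist a b ≤ 1 / 2 := by
    have := hab.trans (min_le_left _ _)
    rw [le_div_iff₀ (by positivity)] at this
    linarith
  have h2 : 2 * L * K ^ 2 * dist a b ≤ 1 / 2 := by
    have := hab.trans (min_le_right _ _)
    rw [le_div_iff₀ (by positivity)] at this
    linarith
  have h3 := h.dist_le_of_exterior_ball hra hc hcK h1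
  have h4 : dist (f (p b)) (f (p a)) / r (p a) ≤ 2 * L * K ^ 2 * dist a b := by
    rw [div_le_iff₀ hra, dist_comm]
    calc dist (f (p a)) (f (p b)) ≤ L * dist (p a) (p b) := hf _ (h.mem a) _ (h.mem b)
      _ ≤ L * (2 * K ^ 2 * r (p a) * dist a b) := by gcongr
      _ = _ := by ring
  have h5 : f (p b) ∈ ball (f (p a)) (r (p a)) := by
    have := h4.trans h2
    rw [div_le_iff₀ hra] at this
    rw [mem_ball]
    linarith
  have h6 := tanh_half_dist_le_of_differentiableOn_ball
    (h'.differentiableOn.mono (hint _ (h.mem a))) h5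
  have h7 := le_four_mul_of_tanh_half_le (by positivity) h2 (h6.trans h4)
  rw [dist_comm]
  linarith

end IsConformalChart

/-- A simply connected domain whose complement contains a disc has a conformal chart. -/
theorem exists_isConformalChart {Ω : Set ℂ} (hΩ : IsOpen Ω) (hΩc : IsSimplyConnected Ω)
    {c : ℂ} {r : ℝ} (hr : 0 < r) (hc : Disjoint (ball c r) Ω) :
    ∃ p q, IsConformalChart p q Ω := by
  obtain ⟨f, hf, hinj, himg⟩ := exists_riemann_map hΩ hΩc hr hc
  obtain ⟨-, g, hg, hgf⟩ := exists_differentiableOn_leftInvOn hΩ hf hinj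
  rw [himg] at hg
  have hfm : ∀ z ∈ Ω, f z ∈ ball (0 : ℂ) 1 := fun z hz => himg ▸ mem_image_of_mem f hz
  have hgm : ∀ ζ ∈ ball (0 : ℂ) 1, g ζ ∈ Ω ∧ f (g ζ) = ζ := by
    intro ζ hζ
    rw [← himg] at hζ
    obtain ⟨z, hz, rfl⟩ := hζ
    rw [hgf hz]
    exact ⟨hz, rfl⟩
  let I := UpperHalfPlane.I
  have hqc : ∀ z ∈ Ω, ((UpperHalfPlane.ofComplex (cayleyInv I (f z)) : ℍ) : ℂ) =
      cayleyInv I (f z) := fun z hz => by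
    rw [UpperHalfPlane.ofComplex_apply_of_im_pos (cayleyInv_im_pos I (hfm z hz))]
  refine ⟨fun a => g (cayley I a), fun z => UpperHalfPlane.ofComplex (cayleyInv I (f z)), ?_, ?_,
    fun a => (hgm _ (cayley_mem_ball I a)).1, fun a => ?_, fun z hz => ?_⟩
  · rw [UpperHalfPlane.mdifferentiable_iff]
    refine DifferentiableOn.congr (f := fun ζ => g (cayley I ζ)) ?_ fun ζ hζ => ?_
    · refine hg.comp (fun ζ hζ => (differentiableAt_cayley I hζ).differentiableWithinAt)
        fun ζ hζ => cayley_mem_ball I ⟨ζ, hζ⟩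
    · simp only [Function.comp_apply]
      rw [UpperHalfPlane.ofComplex_apply_of_im_pos hζ]
  · exact ((differentiableOn_cayleyInv I).comp hf hfm).congr hqc
  · rw [(hgm _ (cayley_mem_ball I a)).2, cayleyInv_cayley I a.im_pos,
      UpperHalfPlane.ofComplex_apply]
  · rw [hqc z hz, cayley_cayleyInv I (hfm z hz), hgf hz]

theorem isConformalChart_upperHalfPlane :
    IsConformalChart (fun a => (a : ℂ)) UpperHalfPlane.ofComplex
      UpperHalfPlane.upperHalfPlaneSet where
  mdifferentiable := UpperHalfPlane.mdifferentiable_coe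
  differentiableOn := differentiableOn_id.congr fun z hz => by
    rw [UpperHalfPlane.ofComplex_apply_of_im_pos hz]; rfl
  mem := fun a => a.im_pos
  left_inv := UpperHalfPlane.ofComplex_apply
  right_inv := fun z hz => by rw [UpperHalfPlane.ofComplex_apply_of_im_pos hz]

/-- Negation is used because complex conjugation is not holomorphic. -/
theorem isConformalChart_lowerHalfPlane :
    IsConformalChart (fun a => -(a : ℂ)) (fun z => UpperHalfPlane.ofComplex (-z))
      lowerHalfPlaneSet where
  mdifferentiable := UpperHalfPlane.mdifferentiable_coe.neg
  differentiableOn := differentiableOn_id.neg.congr fun z hz => by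
    rw [UpperHalfPlane.ofComplex_apply_of_im_pos (by simpa [lowerHalfPlaneSet] using hz)]; rfl
  mem := fun a => by simpa [lowerHalfPlaneSet] using a.im_pos
  left_inv := fun a => by rw [neg_neg, UpperHalfPlane.ofComplex_apply]
  right_inv := fun z hz => by
    rw [UpperHalfPlane.ofComplex_apply_of_im_pos (by simpa [lowerHalfPlaneSet] using hz)]; simp

/-! ### The comparison for F and its inverse -/

/-- A Euclidean bi-Lipschitz homeomorphism of the plane is bi-Lipschitz for the hyperbolic metrics
on a convex domain `Ω` whose reflection in the real axis is its exterior, at the scale `|im z|`. -/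
theorem isHyperbolicBiLipschitz_image {p : ℍ → ℂ} {q : ℂ → ℍ} {Ω : Set ℂ} (hΩ : IsOpen Ω)
    (hconv : Convex ℝ Ω) (h : IsConformalChart p q Ω) (him : ∀ z ∈ Ω, z.im ≠ 0)
    (hin : ∀ z ∈ Ω, ball z |z.im| ⊆ Ω) (hout : ∀ z ∈ Ω, Disjoint (ball (conj z) |z.im|) Ω)
    (F : ℂ ≃ₜ ℂ)
    (hF : IsBiLipschitzWrt (fun z w : ℂ => dist z w) (fun z w : ℂ => dist z w) F) :
    IsHyperbolicBiLipschitz (F.image Ω) := by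
  obtain ⟨L, hL1, hL⟩ := hF
  have hL0 : 0 < L := by linarith
  have hlow : ∀ z w, dist z w ≤ L * dist (F z) (F w) := fun z w => by
    have := (hL z w).1
    rwa [one_div, inv_mul_le_iff₀ hL0] at this
  have hball : ∀ z s w, F w ∈ ball (F z) (s / L) → w ∈ ball z s := fun z s w hw => by
    rw [mem_ball, lt_div_iff₀ hL0] at hw
    have := hlow w z
    rw [mem_ball]
    linarith
  have hFo : IsOpen (F '' Ω) := F.isOpenMap _ hΩ
  have hpos : ∀ z ∈ Ω, 0 < |z.im| / L := fun z hz => div_pos (abs_pos.2 (him z hz)) hL0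
  have hdisj : ∀ z ∈ Ω, Disjoint (ball (F (conj z)) (|z.im| / L)) (F '' Ω) := fun z hz => by
    rw [Set.disjoint_right]
    rintro _ ⟨w, hw, rfl⟩ h1
    exact Set.disjoint_right.1 (hout z hz) hw (hball _ _ _ h1)
  have hconj : ∀ z : ℂ, dist z (conj z) = 2 * |z.im| := fun z => by
    rw [Complex.dist_self_conj]
  have hle : ∀ z : ℂ, |z.im| / L ≤ |z.im| := fun z => div_le_self (abs_nonneg _) hL1
  have hsc : IsSimplyConnected (F '' Ω) := by
    rw [Homeomorph.isSimplyConnected_image]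
    have := hconv.contractibleSpace (h.range_eq ▸ range_nonempty p)
    exact SimplyConnectedSpace.ofContractible Ω
  obtain ⟨z₀, hz₀⟩ : Ω.Nonempty := h.range_eq ▸ range_nonempty p
  obtain ⟨p', q', h'⟩ := exists_isConformalChart hFo hsc (hpos z₀ hz₀) (hdisj z₀ hz₀)
  -- The centres z and conj z are 2|im z| = 2L · (|im z|/L) apart, hence K = 2L.
  obtain ⟨C₁, hC₁⟩ := h.exists_dist_le_mul_dist h' (f := F) (r := fun z => |z.im| / L)
    (K := 2 * L) hL0 (by positivity) hpos (fun z _ w _ => (hL z w).2)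
    (fun z hz w hw => by
      refine ⟨F.symm w, hin z hz (hball _ _ _ ?_), F.apply_symm_apply w⟩
      rwa [F.apply_symm_apply])
    (fun z hz => ⟨conj z, (hout z hz).mono_left (ball_subset_ball (hle z)), by
      rw [hconj]; field_simp; exact le_rfl⟩)
  have hsymm : ∀ z ∈ F '' Ω, F.symm z ∈ Ω := by
    rintro _ ⟨z, hz, rfl⟩
    rwa [F.symm_apply_apply]
  -- Here the exterior centre is the image of the reflected point; F stretches 2|im z| by at most L,
  -- hence K = 2L².
  obtain ⟨C₂, hC₂⟩ := h'.exists_dist_le_mul_dist h (f := F.symm)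
    (r := fun z => |(F.symm z).im| / L) (K := 2 * L ^ 2) hL0 (by positivity)
    (fun z hz => hpos _ (hsymm z hz))
    (fun z _ w _ => by simpa using hlow (F.symm z) (F.symm w))
    (fun z hz => (ball_subset_ball (hle _)).trans (hin _ (hsymm z hz)))
    (fun z hz => ⟨F (conj (F.symm z)), hdisj _ (hsymm z hz), by
      have h1 := (hL (F.symm z) (conj (F.symm z))).2
      simp only [F.apply_symm_apply, hconj] at h1
      refine h1.trans_eq ?_
      field_simp⟩)
  refine ⟨h.isHyperbolicDomain hΩ, h'.isHyperbolicDomain hFo, max 1 (max C₁ C₂), le_max_left _ _,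
    fun z w => ?_⟩
  have hz' : F z ∈ F '' Ω := mem_image_of_mem F z.2
  have hw' : F w ∈ F '' Ω := mem_image_of_mem F w.2
  have e1 := h.hyperbolicDist_eq hΩ z.2 w.2
  have e2 : hyperbolicDist (F '' Ω) (F.image Ω z) (F.image Ω w) = dist (q' (F z)) (q' (F w)) :=
    h'.hyperbolicDist_eq hFo hz' hw'
  have hM : 0 < max 1 (max C₁ C₂) := lt_max_of_lt_left one_pos
  simp only [e1, e2]
  constructor
  · rw [one_div, inv_mul_le_iff₀ hM]
    have := hC₂ _ hz' _ hw'
    rw [F.symm_apply_apply, F.symm_apply_apply] at this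
    exact this.trans (by gcongr; exact (le_max_right _ _).trans (le_max_right _ _))
  · exact (hC₁ _ z.2 _ w.2).trans
      (by gcongr; exact (le_max_left _ _).trans (le_max_right _ _))

theorem abs_im_sub_lt_of_mem_ball {z w : ℂ} {r : ℝ} (hw : w ∈ ball z r) : |w.im - z.im| < r :=
  (Complex.abs_im_le_norm (w - z)).trans_lt (mem_ball_iff_norm.1 hw)

theorem mainTheorem3 (F : ℂ ≃ₜ ℂ)
    (hF : IsBiLipschitzWrt (fun z w : ℂ => dist z w) (fun z w : ℂ => dist z w) F) :
    IsHyperbolicBiLipschitz (F.image UpperHalfPlane.upperHalfPlaneSet) ∧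
      IsHyperbolicBiLipschitz (F.image lowerHalfPlaneSet) := by
  constructor
  · refine isHyperbolicBiLipschitz_image UpperHalfPlane.isOpen_upperHalfPlaneSet
      (convex_halfSpace_im_gt 0) isConformalChart_upperHalfPlane (fun z hz => ne_of_gt hz)
      (fun z hz w hw => ?_) (fun z hz => Set.disjoint_left.2 fun w hw hw' => ?_) F hF
    all_goals
      change 0 < z.im at hz
      have h1 := abs_lt.1 (abs_im_sub_lt_of_mem_ball hw)
      rw [abs_of_pos hz] at h1
    · change 0 < w.im
      linarith
    · change 0 < w.im at hw'
      rw [Complex.conj_im] at h1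
      linarith
  · refine isHyperbolicBiLipschitz_image (isOpen_lt Complex.continuous_im continuous_const)
      (convex_halfSpace_im_lt 0) isConformalChart_lowerHalfPlane (fun z hz => ne_of_lt hz)
      (fun z hz w hw => ?_) (fun z hz => Set.disjoint_left.2 fun w hw hw' => ?_) F hF
    all_goals
      change z.im < 0 at hz
      have h1 := abs_lt.1 (abs_im_sub_lt_of_mem_ball hw)
      rw [abs_of_neg hz] at h1
    · change w.im < 0
      linarith
    · change w.im < 0 at hw'
      rw [Complex.conj_im] at h1
      linarith
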